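/- Theorem (Effective Hypercube Nullstellensatz). Let $n \ge 0$ be an integer and let $g_1, g_2 \in \mathbb{R}[X_1,\dots,X_n]$. Suppose that $g_1$ and $g_2$ have no common zero on the hypercube $\{0,1\}^n$, and that $g_1(x)\, g_2(x) = 0$ for all $x \in \{0,1\}^n$. Then there exist $h_1, h_2 \in \mathbb{R}[X_1,\dots,X_n]$ such that $$h_1(x) g_1(x) + h_2(x) g_2(x) = 1 \quad \text{for all } x \in \{0,1\}^n$$ and $$\max\bigl(\deg(\overline{h_1 g_1}),\, \deg(\overline{h_2 g_2})\bigr) \le 2 \deg(g_1)^2 \deg(g_2)^2.$$ Here $\deg$ denotes the total degree, with the convention $\deg(0) = 0$, and $\overline{p}$ denotes the multilinearization of $p$, that is, the polynomial obtained from $p$ by using the relations $X_1^2 = X_1, \dots, X_n^2 = X_n$ to replace every positive exponent in every monomial by $1$. -/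

import Mathlib

/-- The hypercube `{0,1}ⁿ`, as a set of points of `ℝⁿ`. -/
def hypercube (n : ℕ) : Set (Fin n → ℝ) :=
  {x | ∀ i, x i = 0 ∨ x i = 1}

/-- The multilinearization of a polynomial, obtained from the relations `X i ^ 2 = X i`: in each
monomial, every positive exponent is replaced by `1` (and like terms are then collected). -/
noncomputable def multilinearization {n : ℕ} (p : MvPolynomial (Fin n) ℝ) :
    MvPolynomial (Fin n) ℝ :=
  ∑ d ∈ p.support, MvPolynomial.C (p.coeff d) * ∏ i ∈ d.support, MvPolynomial.X i

/-! On the cube exactly one of `g₁`, `g₂` vanishes at each point, so taking `hᵢ` to interpolate `1 /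
gᵢ` (with `0⁻¹ = 0`) makes `h₁ g₁` the indicator of the zeros of `g₂`, and `h₂ g₂` its complement.
It remains to bound the degree of this indicator (`indicator_zeros_mem`).

Query coordinates as in a decision tree. A maximal family of disjoint top-degree monomials of `g₂`
meets all top-degree monomials, so fixing its variables lowers the degree of `g₂`; after at most
`deg g₂` rounds `g₂` is constant. The family has at most `2 (deg g₁)²` members
(`card_disjoint_top_le`): from a point where `|g₁|` is maximal, changing the variables of one member
can reach a non-root of `g₂`, hence a root of `g₁`. This gives a function on a smaller cube,
extremal at the origin and zero at its neighbours; symmetrization and Markov's inequality bound the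
dimension. -/

open Finset Polynomial in
/-- Markov's inequality for the derivative at the endpoint `0` of `[0, 1]`. -/
theorem neg_derivative_eval_zero_le {P : ℝ[X]} {d : ℕ} (hd : P.natDegree ≤ d) {K : ℝ} (hK : 0 < K)
    (hP : ∀ t ∈ Set.Icc (0 : ℝ) 1, |P.eval t| ≤ K) :
    -(P.derivative.eval 0) ≤ 2 * d ^ 2 * K := by
  -- The substitution `t = (1 - x) / 2` carries `[-1, 1]` to `[0, 1]` and `1` to `0`; its slope
  -- gives the factor `2`, and `T_d'(1) = d²` the rest.
  have key := Polynomial.Chebyshev.eval_iterate_derivative_le_of_forall_abs_le_one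
    (n := d) (P := C K⁻¹ * P.comp (C (1 / 2) - C (1 / 2) * X)) (k := 1) (x := 1) le_rfl ?_ ?_
  · have hT := Polynomial.Chebyshev.derivative_T_eval_one (R := ℝ) d
    simp only [Function.iterate_one] at key
    rw [hT] at key
    simp only [derivative_mul, derivative_C, derivative_comp, derivative_sub, derivative_X,
      eval_mul, eval_C, eval_comp, eval_sub, eval_X, eval_zero, zero_mul,
      zero_add, mul_one, sub_self] at key
    norm_num at key
    rw [← mul_neg, inv_mul_le_iff₀ hK] at key
    linarith
  · refine degree_le_of_natDegree_le ((natDegree_C_mul_le _ _).trans (natDegree_comp_le.trans ?_))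
    have : (C (1 / 2 : ℝ) - C (1 / 2) * X).natDegree ≤ 1 := by compute_degree
    nlinarith
  · intro x hx
    have := hP (1 / 2 - 1 / 2 * x) ⟨by linarith [hx.2], by linarith [hx.1]⟩
    simp only [eval_mul, eval_C, eval_comp, eval_sub, eval_X]
    rw [abs_mul, abs_of_pos (inv_pos.2 hK), inv_mul_le_iff₀ hK]
    simpa using this

/-! ### Functions of bounded degree on the cube -/

/-- The functions on the cube `{0,1}^σ`, whose points are identified with subsets of `σ`, that are
given by a polynomial of degree at most `d`. -/
def cubePoly (σ : Type*) [DecidableEq σ] (d : ℕ) : Submodule ℝ (Finset σ → ℝ) :=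
  Submodule.span ℝ {m | ∃ J : Finset σ, J.card ≤ d ∧ m = fun B => if J ⊆ B then 1 else 0}

namespace cubePoly

variable {σ τ : Type*} [DecidableEq σ] [DecidableEq τ]

theorem monomial_mem {J : Finset σ} {d : ℕ} (h : J.card ≤ d) :
    (fun B => if J ⊆ B then (1 : ℝ) else 0) ∈ cubePoly σ d :=
  Submodule.subset_span ⟨J, h, rfl⟩

theorem mono {d e : ℕ} (h : d ≤ e) : cubePoly σ d ≤ cubePoly σ e :=
  Submodule.span_mono fun _ ⟨J, hJ, hm⟩ => ⟨J, hJ.trans h, hm⟩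

theorem const_mem (a : ℝ) (d : ℕ) : (fun _ => a) ∈ cubePoly σ d := by
  convert (cubePoly σ d).smul_mem a (monomial_mem (J := ∅) (by simp)) using 1
  ext B; simp

theorem coord_mem (i : σ) : (fun B => if i ∈ B then (1 : ℝ) else 0) ∈ cubePoly σ 1 := by
  simpa using monomial_mem (J := {i}) (d := 1) (by simp)

theorem mul_mem {d e : ℕ} {F G : Finset σ → ℝ} (hF : F ∈ cubePoly σ d) (hG : G ∈ cubePoly σ e) :
    F * G ∈ cubePoly σ (d + e) := by
  induction hF using Submodule.span_induction with
  | zero => simp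
  | add x y _ _ hx hy => rw [add_mul]; exact add_mem hx hy
  | smul a x _ hx => rw [smul_mul_assoc]; exact Submodule.smul_mem _ a hx
  | mem x hx =>
    obtain ⟨J, hJ, rfl⟩ := hx
    induction hG using Submodule.span_induction with
    | zero => simp
    | add x y _ _ hx hy => rw [mul_add]; exact add_mem hx hy
    | smul a x _ hx => rw [mul_smul_comm]; exact Submodule.smul_mem _ a hx
    | mem x hx =>
      obtain ⟨K, hK, rfl⟩ := hx
      convert monomial_mem (J := J ∪ K) (d := d + e)
        ((Finset.card_union_le J K).trans (add_le_add hJ hK)) using 1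
      ext B
      by_cases h₁ : J ⊆ B <;> by_cases h₂ : K ⊆ B <;> simp [Finset.union_subset_iff, h₁, h₂]

theorem prod_mem {ι : Type*} (s : Finset ι) (F : ι → Finset σ → ℝ)
    (hF : ∀ i ∈ s, F i ∈ cubePoly σ 1) : ∏ i ∈ s, F i ∈ cubePoly σ s.card := by
  classical
  induction s using Finset.induction_on with
  | empty => exact const_mem 1 0
  | insert a s ha ih =>
    rw [Finset.prod_insert ha, Finset.card_insert_of_notMem ha, add_comm]
    exact mul_mem (hF a (by simp)) (ih fun i hi => hF i (by simp [hi]))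

/-- A monomial in `J` pulls back to a product of `J.card` functions of degree at most `1`. -/
theorem comp_mem {d : ℕ} {F : Finset σ → ℝ} (hF : F ∈ cubePoly σ d) (φ : Finset τ → Finset σ)
    (hφ : ∀ i, (fun B => if i ∈ φ B then (1 : ℝ) else 0) ∈ cubePoly τ 1) :
    F ∘ φ ∈ cubePoly τ d := by
  induction hF using Submodule.span_induction with
  | zero => exact zero_mem _
  | add x y _ _ hx hy => exact add_mem hx hy
  | smul a x _ hx => exact Submodule.smul_mem _ a hx
  | mem x hx =>
    obtain ⟨J, hJ, rfl⟩ := hx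
    convert mono hJ (prod_mem J (fun i B => if i ∈ φ B then (1 : ℝ) else 0) fun i _ => hφ i) using 1
    ext B
    simp [Finset.prod_apply, Finset.prod_ite_zero, Finset.subset_iff]

theorem exists_coeff {d : ℕ} {F : Finset σ → ℝ} (hF : F ∈ cubePoly σ d) :
    ∃ c : Finset σ → ℝ, (∀ J, d < J.card → c J = 0) ∧ ∀ B, F B = ∑ J ∈ B.powerset, c J := by
  induction hF using Submodule.span_induction with
  | zero => exact ⟨0, by simp, by simp⟩
  | add x y _ _ hx hy =>
    obtain ⟨c, hc, hx⟩ := hx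
    obtain ⟨e, he, hy⟩ := hy
    exact ⟨c + e, fun J hJ => by simp [hc J hJ, he J hJ],
      fun B => by simp [hx, hy, Finset.sum_add_distrib]⟩
  | smul a x _ hx =>
    obtain ⟨c, hc, hx⟩ := hx
    exact ⟨a • c, fun J hJ => by simp [hc J hJ], fun B => by simp [hx, Finset.mul_sum]⟩
  | mem x hx =>
    obtain ⟨J, hJ, rfl⟩ := hx
    refine ⟨fun K => if J = K then 1 else 0, fun K hK => if_neg ?_, fun B => by simp⟩
    rintro rfl
    omega

/-- The coefficients of a multilinear polynomial are determined by its values on the cube. -/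
theorem coeff_unique {c e : Finset σ → ℝ}
    (h : ∀ B : Finset σ, ∑ J ∈ B.powerset, c J = ∑ J ∈ B.powerset, e J) : c = e := by
  ext B
  induction B using Finset.strongInduction with
  | H B ih =>
    have hB := h B
    rw [← Finset.sum_erase_add _ _ (Finset.mem_powerset_self B),
      ← Finset.sum_erase_add _ _ (Finset.mem_powerset_self B)] at hB
    rw [Finset.sum_congr rfl fun J hJ => ih J (by
      rw [Finset.mem_erase, Finset.mem_powerset] at hJ
      exact lt_of_le_of_ne hJ.2 hJ.1)] at hB
    exact add_left_cancel hB

/-! ### Sensitivity and disjoint top-degree monomials -/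

/-- A function of degree at most `d` on the cube that is maximal in absolute value at the origin and
vanishes at all its neighbours lives on a cube of dimension at most `2 * d ^ 2`. -/
theorem card_le_of_sensitive [Fintype σ] {d : ℕ} {F : Finset σ → ℝ} (hF : F ∈ cubePoly σ d)
    (hmax : ∀ B, |F B| ≤ |F ∅|) (h₀ : F ∅ ≠ 0) (h₁ : ∀ i, F {i} = 0) :
    Fintype.card σ ≤ 2 * d ^ 2 := by
  open Polynomial in
  wlog hpos : 0 < F ∅ generalizing F
  · refine this (F := -F) (neg_mem hF) (by simpa using hmax) (by simpa using h₀)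
      (by simpa using h₁) ?_
    simpa using lt_of_le_of_ne (not_lt.1 hpos) h₀
  obtain ⟨c, hc, hFc⟩ := exists_coeff hF
  have hc₀ : c ∅ = F ∅ := by simp [hFc]
  have hc₁ : ∀ i, c {i} = -F ∅ := fun i => by
    have h := hFc {i}
    have hp : ({i} : Finset σ).powerset = {∅, {i}} := by
      ext s; simp [Finset.subset_singleton_iff]
    rw [h₁, hp, Finset.sum_pair (Finset.singleton_ne_empty i).symm, hc₀] at h
    linarith
  -- `P t` is the mean of `F` over a random set containing each point independently with probability
  -- `t`: a set `J` is contained in it with probability `t ^ J.card`.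
  set P : ℝ[X] := ∑ J : Finset σ, Polynomial.C (c J) * Polynomial.X ^ J.card with hP
  have hdeg : P.natDegree ≤ d := by
    refine Polynomial.natDegree_sum_le_of_forall_le _ _ fun J _ => ?_
    by_cases hJ : J.card ≤ d
    · exact (Polynomial.natDegree_C_mul_X_pow_le _ _).trans hJ
    · simp [hc J (not_le.1 hJ)]
  have hcoeff : P.derivative.eval 0 = -(Fintype.card σ * F ∅) := by
    rw [← Polynomial.coeff_zero_eq_eval_zero, Polynomial.coeff_derivative]
    simp only [hP, Polynomial.finsetSum_coeff, Polynomial.coeff_C_mul, Polynomial.coeff_X_pow]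
    have : ∑ J : Finset σ, c J * (if 0 + 1 = J.card then (1 : ℝ) else 0)
        = ∑ J ∈ Finset.univ.powersetCard 1, c J := by
      simp only [mul_ite, mul_one, mul_zero, ← Finset.sum_filter]
      refine Finset.sum_congr ?_ fun _ _ => rfl
      ext J; simp [Finset.mem_powersetCard, eq_comm]
    rw [this, Finset.powersetCard_one, Finset.sum_map]
    simp [hc₁]
  have heval : ∀ t u : ℝ, t + u = 1 → P.eval t = ∑ B : Finset σ,
      t ^ B.card * u ^ (Fintype.card σ - B.card) * F B := by
    intro t u htu
    have hJ : ∀ J : Finset σ, t ^ J.card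
        = ∑ B : Finset σ, if J ⊆ B then t ^ B.card * u ^ (Fintype.card σ - B.card) else 0 := by
      intro J
      rw [← Finset.sum_filter]
      have h := Finset.sum_pow_mul_eq_add_pow t u (Finset.univ \ J)
      rw [htu, one_pow] at h
      rw [← mul_one (t ^ J.card), ← h, Finset.mul_sum]
      refine Finset.sum_bij' (fun T _ => J ∪ T) (fun B _ => B \ J) ?_ ?_ ?_ ?_ ?_
      · intro T _; simp
      · intro B _
        rw [Finset.mem_powerset]
        exact Finset.sdiff_subset_sdiff (Finset.subset_univ _) le_rfl
      · intro T hT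
        rw [Finset.mem_powerset] at hT
        ext i
        have := @hT i
        simp only [Finset.mem_sdiff, Finset.mem_univ, true_and, Finset.mem_union] at *
        tauto
      · intro B hB
        exact Finset.union_sdiff_of_subset (by simpa using hB)
      · intro T hT
        rw [Finset.mem_powerset] at hT
        have hd : Disjoint J T := Finset.disjoint_left.2 fun i hi hi' => by
          have := hT hi'
          simp [hi] at this
        rw [Finset.card_union_of_disjoint hd, Finset.card_sdiff_of_subset (Finset.subset_univ J),
          Finset.card_univ, pow_add, Nat.sub_sub, mul_assoc]
    rw [hP, Polynomial.eval_finsetSum]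
    simp only [Polynomial.eval_mul, Polynomial.eval_C, Polynomial.eval_pow, Polynomial.eval_X]
    rw [Finset.sum_congr rfl fun J _ => by rw [hJ J, Finset.mul_sum], Finset.sum_comm]
    refine Finset.sum_congr rfl fun B _ => ?_
    rw [hFc, Finset.mul_sum, ← Finset.filter_subset_univ, Finset.sum_filter]
    refine Finset.sum_congr rfl fun J _ => ?_
    split_ifs <;> ring
  have hbound : ∀ t ∈ Set.Icc (0 : ℝ) 1, |P.eval t| ≤ F ∅ := by
    intro t ht
    obtain ⟨u, htu⟩ : ∃ u, t + u = 1 := ⟨1 - t, by ring⟩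
    have hu : 0 ≤ u := by linarith [ht.2]
    have h1 := Finset.sum_pow_mul_eq_add_pow t u (Finset.univ : Finset σ)
    rw [htu, one_pow, Finset.powerset_univ, Finset.card_univ] at h1
    rw [heval t u htu, ← one_mul (F ∅), ← h1, Finset.sum_mul]
    refine (Finset.abs_sum_le_sum_abs _ _).trans (Finset.sum_le_sum fun B _ => ?_)
    have hw : 0 ≤ t ^ B.card * u ^ (Fintype.card σ - B.card) :=
      mul_nonneg (pow_nonneg ht.1 _) (pow_nonneg hu _)
    rw [abs_mul, abs_of_nonneg hw]
    exact mul_le_mul_of_nonneg_left ((hmax B).trans_eq (abs_of_pos hpos)) hw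
  have := neg_derivative_eval_zero_le hdeg hpos hbound
  rw [hcoeff, neg_neg] at this
  exact_mod_cast le_of_mul_le_mul_right this hpos

/-- If `M` is a top-degree monomial of a multilinear polynomial, then every point of the cube can be
moved to a non-root by changing only coordinates in `M`. -/
theorem exists_ne_zero_of_top_coeff [Fintype σ] {m : ℕ} {G c : Finset σ → ℝ}
    (hc : ∀ J, m < J.card → c J = 0) (hG : ∀ B, G B = ∑ J ∈ B.powerset, c J)
    {M : Finset σ} (hM : M.card = m) (hcM : c M ≠ 0) (y : Finset σ) :
    ∃ z, z \ M = y \ M ∧ G z ≠ 0 := by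
  by_contra! hcon
  -- The coefficients, in the variables of `M`, of `G` with the other coordinates fixed as in `y`.
  -- At `M` only `c M` survives, since any other contributing `J` strictly contains `M`.
  set e : Finset σ → ℝ := fun K => ∑ J : Finset σ, if J ∩ M = K ∧ J \ M ⊆ y then c J else 0
  have he : e = 0 := by
    refine coeff_unique fun B => ?_
    have hz := hcon (y \ M ∪ B ∩ M) (by ext i; simp; tauto)
    rw [hG] at hz
    simp only [Pi.zero_apply, Finset.sum_const_zero]
    rw [← hz, Finset.sum_comm, ← Finset.filter_subset_univ (y \ M ∪ B ∩ M), Finset.sum_filter]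
    refine Finset.sum_congr rfl fun J _ => ?_
    have hiff : J ⊆ y \ M ∪ B ∩ M ↔ J ∩ M ⊆ B ∧ J \ M ⊆ y := by
      simp only [Finset.subset_iff, Finset.mem_union, Finset.mem_sdiff, Finset.mem_inter,
        ← forall_and]
      exact forall_congr' fun i => by tauto
    by_cases h : J \ M ⊆ y <;> simp [hiff, h]
  refine hcM ?_
  rw [← Pi.zero_apply (M := fun _ => ℝ) M, ← he]
  symm
  simp only [e]
  rw [Finset.sum_eq_single M]
  · simp
  · intro J _ hJ
    split_ifs with h
    · refine hc J ?_
      rw [← hM]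
      exact Finset.card_lt_card (lt_of_le_of_ne (Finset.inter_eq_right.1 h.1) (Ne.symm hJ))
    · rfl
  · simp

/-- If `F * G` vanishes on the cube but `F` and `G` have no common root there, then pairwise
disjoint top-degree monomials of `G` number at most `2 * d ^ 2`, where `d` bounds the degree
of `F`. -/
theorem card_disjoint_top_le [Fintype σ] {d m : ℕ} {F G c : Finset σ → ℝ} (hF : F ∈ cubePoly σ d)
    (hc : ∀ J, m < J.card → c J = 0) (hG : ∀ B, G B = ∑ J ∈ B.powerset, c J)
    (hprod : ∀ B, F B * G B = 0) (hF0 : F ≠ 0)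
    {S : Finset (Finset σ)} (hS : ∀ M ∈ S, M.card = m ∧ c M ≠ 0)
    (hdisj : (S : Set (Finset σ)).PairwiseDisjoint id) :
    S.card ≤ 2 * d ^ 2 := by
  obtain ⟨y, -, hy⟩ := Finset.exists_max_image Finset.univ (fun B => |F B|) Finset.univ_nonempty
  have hFy : F y ≠ 0 := fun h => hF0 <| by
    ext B
    have := hy B (Finset.mem_univ B)
    rw [h, abs_zero] at this
    simpa using this
  choose! z hzy hz using fun M (hM : M ∈ S) =>
    exists_ne_zero_of_top_coeff hc hG (hS M hM).1 (hS M hM).2 y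
  -- Start from `y` and replace it by `z M` on each block `M ∈ B`. The blocks are disjoint, so each
  -- coordinate depends on at most one bit of `B`, and degrees do not grow.
  let φ : Finset S → Finset σ := fun B =>
    Finset.univ.filter fun i => if ∃ M ∈ B, i ∈ M.1 then ∃ M ∈ B, i ∈ M.1 ∧ i ∈ z M else i ∈ y
  have hφ₀ : φ ∅ = y := by ext i; simp [φ]
  have hφ₁ : ∀ M : S, φ {M} = z M := by
    intro M
    ext i
    have h := congrArg (i ∈ ·) (hzy M.1 M.2)
    by_cases hi : i ∈ M.1
    · simp [φ, hi]
    · simpa [φ, hi, eq_comm] using h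
  have hφ : ∀ i, (fun B => if i ∈ φ B then (1 : ℝ) else 0) ∈ cubePoly S 1 := by
    intro i
    by_cases hi : ∃ M : S, i ∈ M.1
    · obtain ⟨M, hiM⟩ := hi
      have huniq : ∀ N : S, i ∈ N.1 → N = M := fun N hN => Subtype.ext <|
        hdisj.elim_finset N.2 M.2 i hN hiM
      have hmem : ∀ B, i ∈ φ B ↔ if M ∈ B then i ∈ z M else i ∈ y := by
        intro B
        have h1 : (∃ N ∈ B, i ∈ N.1) ↔ M ∈ B :=
          ⟨fun ⟨N, hN, hi⟩ => huniq N hi ▸ hN, fun h => ⟨M, h, hiM⟩⟩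
        have h2 : (∃ N ∈ B, i ∈ N.1 ∧ i ∈ z N) ↔ M ∈ B ∧ i ∈ z M :=
          ⟨fun ⟨N, hN, hi, hi'⟩ => by rw [← huniq N hi]; exact ⟨hN, hi'⟩,
            fun h => ⟨M, h.1, hiM, h.2⟩⟩
        simp only [φ, Finset.mem_filter, Finset.mem_univ, true_and, h1, h2]
        split_ifs with h <;> simp [h]
      convert add_mem (const_mem (σ := S) (if i ∈ y then 1 else 0) 1)
        ((cubePoly S 1).smul_mem ((if i ∈ z M then 1 else 0) - (if i ∈ y then 1 else 0))
          (coord_mem M)) using 1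
      ext B
      simp only [hmem, Pi.add_apply, Pi.smul_apply, smul_eq_mul]
      by_cases hB : M ∈ B <;> simp [hB]
    · have : ∀ B, i ∈ φ B ↔ i ∈ y := by
        intro B
        have h1 : ¬ ∃ N ∈ B, i ∈ N.1 := fun ⟨N, _, h⟩ => hi ⟨N, h⟩
        simp only [φ, Finset.mem_filter, Finset.mem_univ, true_and, if_neg h1]
      simp only [this]
      exact const_mem _ 1
  have := card_le_of_sensitive (comp_mem hF φ hφ)
    (fun B => by simpa [hφ₀] using hy (φ B) (Finset.mem_univ _)) (by simpa [hφ₀] using hFy)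
    (fun M => by simpa [hφ₁, hz M.1 M.2] using hprod (z M))
  simpa using this

/-! ### Restrictions and the decision-tree induction -/

theorem indicator_inter_mem (S A : Finset σ) :
    (fun B => if B ∩ S = A ∩ S then (1 : ℝ) else 0) ∈ cubePoly σ S.card := by
  convert prod_mem S (fun i B => if i ∈ B ↔ i ∈ A then (1 : ℝ) else 0) fun i _ => ?_ using 1
  · ext B
    have : B ∩ S = A ∩ S ↔ ∀ i ∈ S, i ∈ B ↔ i ∈ A := by
      simp only [Finset.ext_iff, Finset.mem_inter]
      exact forall_congr' fun i => by tauto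
    simp [Finset.prod_apply, Finset.prod_ite_zero, this]
  · by_cases hi : i ∈ A
    · simpa [hi] using coord_mem i
    · convert sub_mem (const_mem (σ := σ) 1 1) (coord_mem i) using 1
      ext B
      by_cases hB : i ∈ B <;> simp [hi, hB]

theorem restrict_coord_mem (S A : Finset σ) (i : σ) :
    (fun B => if i ∈ B \ S ∪ A then (1 : ℝ) else 0) ∈ cubePoly σ 1 := by
  by_cases hA : i ∈ A
  · simpa [hA] using const_mem (σ := σ) 1 1
  by_cases hS : i ∈ S
  · simpa [hA, hS] using const_mem (σ := σ) 0 1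
  · simpa [hA, hS] using coord_mem i

/-- Fixing a set of coordinates that meets every top-degree monomial lowers the degree. -/
theorem restrict_mem [Fintype σ] {m : ℕ} {G c : Finset σ → ℝ} (hc : ∀ J, m + 1 < J.card → c J = 0)
    (hG : ∀ B, G B = ∑ J ∈ B.powerset, c J) {S : Finset σ}
    (hS : ∀ J, J.card = m + 1 → c J ≠ 0 → ¬ Disjoint J S) (A : Finset σ) :
    (fun B => G (B \ S ∪ A)) ∈ cubePoly σ m := by
  have : (fun B => G (B \ S ∪ A)) = ∑ J : Finset σ,
      c J • ((fun B => if J ⊆ B then (1 : ℝ) else 0) ∘ fun B => B \ S ∪ A) := by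
    ext B
    simp [hG, Finset.sum_apply, ← Finset.sum_filter, ← Finset.filter_subset_univ]
  rw [this]
  refine sum_mem fun J _ => ?_
  by_cases hcJ : c J = 0
  · simp [hcJ]
  refine Submodule.smul_mem _ _ ?_
  by_cases hd : Disjoint J S
  · refine comp_mem (monomial_mem ?_) _ (restrict_coord_mem S A)
    by_contra hlt
    rcases Nat.lt_or_ge (m + 1) J.card with h | h
    · exact hcJ (hc J h)
    · exact hS J (by omega) hcJ hd
  -- A monomial meeting `S` loses at least one variable if `A` sets all of `J ∩ S` to `1`, and
  -- becomes `0` otherwise.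
  · by_cases hJA : J ∩ S ⊆ A
    · convert comp_mem (monomial_mem (J := J \ S) (d := m) ?_) _ (restrict_coord_mem S A) using 1
      · ext B
        have : J ⊆ B \ S ∪ A ↔ J \ S ⊆ B \ S ∪ A := by
          refine ⟨fun h => Finset.sdiff_subset.trans h, fun h i hi => ?_⟩
          by_cases hiS : i ∈ S
          · exact Finset.mem_union_right _ (hJA (Finset.mem_inter.2 ⟨hi, hiS⟩))
          · exact h (Finset.mem_sdiff.2 ⟨hi, hiS⟩)
        simp [this]
      · have h1 : J.card ≤ m + 1 := not_lt.1 fun h => hcJ (hc J h)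
        have h2 : (J \ S).card < J.card := Finset.card_lt_card <|
          lt_of_le_of_ne Finset.sdiff_subset fun h => hd (Finset.sdiff_eq_self_iff_disjoint.1 h)
        omega
    · obtain ⟨i, hi, hiA⟩ := Finset.not_subset.1 hJA
      rw [Finset.mem_inter] at hi
      convert zero_mem (cubePoly σ m) using 1
      ext B
      have : ¬ J ⊆ B \ S ∪ A := fun h => by simpa [hi.2, hiA] using h hi.1
      simp [this]

/-- The indicator of the zeros of `G` on the cube has degree polynomially bounded in those of
`F` and `G`, if the zeros of `F` are the complement of the zeros of `G`. -/
theorem indicator_zeros_mem [Fintype σ] {d D m : ℕ} (hm : m ≤ D) {F G : Finset σ → ℝ}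
    (hF : F ∈ cubePoly σ d) (hG : G ∈ cubePoly σ m) (hprod : ∀ B, F B * G B = 0)
    (hcommon : ∀ B, F B = 0 → G B ≠ 0) :
    (fun B => if G B = 0 then (1 : ℝ) else 0) ∈ cubePoly σ (m * (2 * d ^ 2 * D)) := by
  classical
  -- Only the degree of `G` drops; `d` and `D` stay fixed, so every round costs at most `2 * d ^ 2 *
  -- D` variables.
  induction m generalizing F G with
  | zero =>
    obtain ⟨c, hc, hGc⟩ := exists_coeff hG
    have : ∀ B, G B = c ∅ := fun B => by
      rw [hGc, Finset.sum_eq_single ∅ (fun J _ hJ => hc J (Finset.card_pos.2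
        (Finset.nonempty_iff_ne_empty.2 hJ))) (by simp)]
    simp only [this]
    exact const_mem _ _
  | succ m ih =>
    by_cases hF0 : F = 0
    · have : ∀ B, G B ≠ 0 := fun B => hcommon B (by simp [hF0])
      simpa [this] using const_mem (σ := σ) 0 _
    obtain ⟨c, hc, hGc⟩ := exists_coeff hG
    let T : Finset (Finset (Finset σ)) := Finset.univ.filter fun S =>
      (∀ M ∈ S, M.card = m + 1 ∧ c M ≠ 0) ∧ (S : Set (Finset σ)).PairwiseDisjoint id
    obtain ⟨S, hST, hSmax⟩ := Finset.exists_max_image T Finset.card ⟨∅, by simp [T]⟩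
    have hS := (Finset.mem_filter.1 hST).2
    have hcard := card_disjoint_top_le hF hc hGc hprod hF0 hS.1 hS.2
    set U := S.biUnion id with hU
    have hUcard : U.card ≤ 2 * d ^ 2 * D :=
      calc U.card ≤ S.card * (m + 1) := Finset.card_biUnion_le_card_mul _ _ _
            fun M hM => (hS.1 M hM).1.le
        _ ≤ 2 * d ^ 2 * D := Nat.mul_le_mul hcard hm
    have hhit : ∀ J : Finset σ, J.card = m + 1 → c J ≠ 0 → ¬ Disjoint J U := by
      intro J hJ hcJ hd
      rw [hU, Finset.disjoint_biUnion_right] at hd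
      have hJS : J ∉ S := fun h => by
        have := hd J h
        rw [id, disjoint_self, Finset.bot_eq_empty] at this
        simp [this] at hJ
      -- A top-degree monomial missing `U` would enlarge the maximal family.
      have := hSmax (insert J S) (by
        simp only [T, Finset.mem_filter, Finset.mem_univ, true_and, Finset.coe_insert]
        refine ⟨fun M hM => ?_, hS.2.insert fun M hM _ => hd M hM⟩
        rcases Finset.mem_insert.1 hM with rfl | hM
        exacts [⟨hJ, hcJ⟩, hS.1 M hM])
      rw [Finset.card_insert_of_notMem hJS] at this
      omega
    -- Split according to the values on `U`; the restriction to each piece falls under the induction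
    -- hypothesis.
    have hdecomp : (fun B => if G B = 0 then (1 : ℝ) else 0) = ∑ A ∈ U.powerset,
        (fun B => if B ∩ U = A ∩ U then (1 : ℝ) else 0) *
          fun B => if G (B \ U ∪ A) = 0 then (1 : ℝ) else 0 := by
      ext B
      rw [Finset.sum_apply, Finset.sum_eq_single (B ∩ U)]
      · have : B \ U ∪ B ∩ U = B := Finset.sdiff_union_inter B U
        simp [this]
      · intro A hA hne
        have : B ∩ U ≠ A ∩ U := fun h => hne <| by
          rw [h, Finset.inter_eq_left.2 (Finset.mem_powerset.1 hA)]
        rw [Pi.mul_apply, if_neg this, zero_mul]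
      · intro h
        simp at h
    rw [hdecomp]
    refine sum_mem fun A _ => mono (by rw [add_mul, one_mul, add_comm]; gcongr) <|
      mul_mem (d := U.card) (e := m * (2 * d ^ 2 * D)) (indicator_inter_mem U A) ?_
    exact ih (by omega) (comp_mem hF (fun B => B \ U ∪ A) (restrict_coord_mem U A))
      (restrict_mem hc hGc hhit A) (fun B => hprod _) (fun B => hcommon _)

end cubePoly

/-! ### From polynomials to functions on the cube and back -/

section MvPolynomial

open MvPolynomial

variable {n : ℕ}

/-- The point of `{0,1}ⁿ` with support `B`. -/
def cubePoint (B : Finset (Fin n)) : Fin n → ℝ := fun i => if i ∈ B then 1 else 0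

theorem cubePoint_mem (B : Finset (Fin n)) : cubePoint B ∈ hypercube n := fun i => by
  by_cases h : i ∈ B <;> simp [cubePoint, h]

theorem exists_eq_cubePoint {x : Fin n → ℝ} (hx : x ∈ hypercube n) : ∃ B, x = cubePoint B := by
  refine ⟨Finset.univ.filter fun i => x i = 1, funext fun i => ?_⟩
  rcases hx i with h | h <;> simp [cubePoint, h]

theorem eval_cubePoint (p : MvPolynomial (Fin n) ℝ) (B : Finset (Fin n)) :
    eval (cubePoint B) p = ∑ s ∈ p.support, p.coeff s * if s.support ⊆ B then 1 else 0 := by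
  rw [eval_eq]
  refine Finset.sum_congr rfl fun s _ => ?_
  congr 1
  rw [Finset.prod_congr rfl (g := fun i => if i ∈ B then (1 : ℝ) else 0) fun i hi => by
    rw [cubePoint, ite_pow, one_pow, zero_pow (Finsupp.mem_support_iff.1 hi)],
    Finset.prod_ite_zero]
  simp [Finset.subset_iff]

theorem eval_cubePoint_mem (p : MvPolynomial (Fin n) ℝ) :
    (fun B => eval (cubePoint B) p) ∈ cubePoly (Fin n) p.totalDegree := by
  have : (fun B => eval (cubePoint B) p) = ∑ s ∈ p.support,
      p.coeff s • fun B => if s.support ⊆ B then (1 : ℝ) else 0 := by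
    ext B
    simp [eval_cubePoint, Finset.sum_apply]
  rw [this]
  refine sum_mem fun s hs => Submodule.smul_mem _ _ (cubePoly.monomial_mem ?_)
  refine le_trans ?_ (le_totalDegree hs)
  rw [Finset.card_eq_sum_ones, Finsupp.sum]
  exact Finset.sum_le_sum fun i hi => Nat.one_le_iff_ne_zero.2 (Finsupp.mem_support_iff.1 hi)

/-- Multilinear coefficients are determined by values on the cube, so those of the
multilinearization are the ones supplied by `exists_coeff`. -/
theorem totalDegree_multilinearization_le {p : MvPolynomial (Fin n) ℝ} {d : ℕ}
    (hp : (fun B => eval (cubePoint B) p) ∈ cubePoly (Fin n) d) :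
    (multilinearization p).totalDegree ≤ d := by
  obtain ⟨c, hc, hpc⟩ := cubePoly.exists_coeff hp
  have hcoeff : c = fun J => ∑ s ∈ p.support with s.support = J, p.coeff s := by
    refine cubePoly.coeff_unique fun B => ?_
    rw [← hpc, eval_cubePoint]
    simp only [Finset.sum_filter]
    rw [Finset.sum_comm]
    exact Finset.sum_congr rfl fun s _ => by simp
  have : multilinearization p = ∑ J : Finset (Fin n), C (c J) * ∏ i ∈ J, X i := by
    rw [multilinearization, ← Finset.sum_fiberwise p.support (fun s => s.support)]
    refine Finset.sum_congr rfl fun J _ => ?_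
    rw [hcoeff, map_sum, Finset.sum_mul]
    refine Finset.sum_congr rfl fun s hs => ?_
    rw [(Finset.mem_filter.1 hs).2]
  rw [this]
  refine totalDegree_finsetSum_le fun J _ => ?_
  by_cases hJ : d < J.card
  · simp [hc J hJ]
  · refine (totalDegree_mul _ _).trans ?_
    rw [totalDegree_C, zero_add]
    refine (totalDegree_finsetProd _ _).trans ?_
    simpa using hJ

/-- Every function on the hypercube is given by a polynomial. -/
theorem exists_eval_cubePoint_eq (F : Finset (Fin n) → ℝ) :
    ∃ p : MvPolynomial (Fin n) ℝ, ∀ B, eval (cubePoint B) p = F B := by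
  refine ⟨∑ A : Finset (Fin n), C (F A) * ∏ i, if i ∈ A then X i else 1 - X i, fun B => ?_⟩
  rw [map_sum, Finset.sum_eq_single B]
  · rw [map_mul, eval_C, map_prod, Finset.prod_eq_one, mul_one]
    intro i _
    by_cases hi : i ∈ B <;> simp [hi, cubePoint]
  · intro A _ hAB
    obtain ⟨i, hi⟩ : ∃ i, ¬ (i ∈ A ↔ i ∈ B) := by
      by_contra! h
      exact hAB (Finset.ext h)
    rw [map_mul, map_prod, Finset.prod_eq_zero (Finset.mem_univ i), mul_zero]
    by_cases hA : i ∈ A <;> simp_all [cubePoint]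
  · simp

end MvPolynomial

theorem mainTheorem6 (n : ℕ) (g₁ g₂ : MvPolynomial (Fin n) ℝ)
    (hcommon : ¬ ∃ x ∈ hypercube n, MvPolynomial.eval x g₁ = 0 ∧ MvPolynomial.eval x g₂ = 0)
    (hprod : ∀ x ∈ hypercube n, MvPolynomial.eval x g₁ * MvPolynomial.eval x g₂ = 0) :
    ∃ h₁ h₂ : MvPolynomial (Fin n) ℝ,
      (∀ x ∈ hypercube n,
        MvPolynomial.eval x h₁ * MvPolynomial.eval x g₁
          + MvPolynomial.eval x h₂ * MvPolynomial.eval x g₂ = 1) ∧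
      max (multilinearization (h₁ * g₁)).totalDegree (multilinearization (h₂ * g₂)).totalDegree
        ≤ 2 * g₁.totalDegree ^ 2 * g₂.totalDegree ^ 2 := by
  let F : Finset (Fin n) → ℝ := fun B => MvPolynomial.eval (cubePoint B) g₁
  let G : Finset (Fin n) → ℝ := fun B => MvPolynomial.eval (cubePoint B) g₂
  have hFG : ∀ B, F B * G B = 0 := fun B => hprod _ (cubePoint_mem B)
  have hne : ∀ B, F B = 0 → G B ≠ 0 := fun B h h' => hcommon ⟨_, cubePoint_mem B, h, h'⟩
  have key := cubePoly.indicator_zeros_mem le_rfl (eval_cubePoint_mem g₁) (eval_cubePoint_mem g₂)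
    hFG hne
  have hD : g₂.totalDegree * (2 * g₁.totalDegree ^ 2 * g₂.totalDegree)
      = 2 * g₁.totalDegree ^ 2 * g₂.totalDegree ^ 2 := by ring
  rw [hD] at key
  -- As `0⁻¹ = 0`, the product `(F B)⁻¹ * F B` is `1` where `F` is nonzero, that is where `G`
  -- vanishes, and `0` elsewhere.
  obtain ⟨h₁, hh₁⟩ := exists_eval_cubePoint_eq fun B => (F B)⁻¹
  obtain ⟨h₂, hh₂⟩ := exists_eval_cubePoint_eq fun B => (G B)⁻¹
  have e₁ : ∀ B, MvPolynomial.eval (cubePoint B) (h₁ * g₁) = if G B = 0 then 1 else 0 := by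
    intro B
    rw [map_mul, hh₁]
    split_ifs with h
    · exact inv_mul_cancel₀ fun hF => hne B hF h
    · exact mul_eq_zero_of_right _ ((mul_eq_zero.1 (hFG B)).resolve_right h)
  have e₂ : ∀ B, MvPolynomial.eval (cubePoint B) (h₂ * g₂) = 1 - if G B = 0 then 1 else 0 := by
    intro B
    rw [map_mul, hh₂]
    split_ifs with h
    · rw [sub_self]
      exact mul_eq_zero_of_right _ h
    · rw [sub_zero]
      exact inv_mul_cancel₀ h
  refine ⟨h₁, h₂, fun x hx => ?_, max_le ?_ ?_⟩
  · obtain ⟨B, rfl⟩ := exists_eq_cubePoint hx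
    rw [← map_mul, ← map_mul, e₁, e₂]
    ring
  · refine totalDegree_multilinearization_le ?_
    simp only [e₁]
    exact key
  · refine totalDegree_multilinearization_le ?_
    simp only [e₂]
    exact sub_mem (cubePoly.const_mem 1 _) key
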